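/- **Model.** Let $n\ge 1$. A $t$-query quantum decision tree $\mathcal A$ ($t\ge 0$) on inputs $x\in\{0,1\}^n$ is given by unitaries $U_0,\dots,U_t$ with real entries, acting on a query register (basis $|i\rangle$, $i\in[n]$), a one-bit answer register and a finite-dimensional work register. With the query operator $O_x|i\rangle|b\rangle|z\rangle=|i\rangle|b\oplus x_i\rangle|z\rangle$, its output $\mathcal A(x)$ is the result of measuring $U_tO_xU_{t-1}O_x\cdots O_xU_0|0\rangle|0\rangle|0\rangle$ in the computational basis. A hybrid decision tree is a finite rooted tree in which every internal node $v$ carries a quantum decision tree $\mathcal A_v$, with exactly one child for each possible outcome of $\mathcal A_v$, and every leaf is labelled with a bit. On input $x$ one starts at the root, and at each internal node $v$ runs $\mathcal A_v$ on $x$ and moves to the child given by the outcome; the output is the label of the leaf that is reached. The cost of the tree is the maximum over root-to-leaf paths of the total number of queries of the $\mathcal A_v$ on the path. The tree is $q$-limited if each $\mathcal A_v$ makes at most $q$ queries. It computes $f:D\to\{0,1\}$, $D\subseteq\{0,1\}^n$, if for every $x\in D$ it outputs $f(x)$ with probability at least $2/3$. Let $H_q(f)$ be the minimal cost of a $q$-limited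 hybrid decision tree that computes $f$. For $f:D\to\{0,1\}$, the block sensitivity $\mathrm{bs}(f)$ is the maximal $k$ for which there are $x\in D$ and pairwise disjoint blocks $B_1,\dots,B_k\subseteq[n]$ such that, for every $j$, the input $x^{B_j}$ obtained from $x$ by flipping the bits in $B_j$ lies in $D$ and $f(x^{B_j})\ne f(x)$ (and $\mathrm{bs}(f)=0$ if $D=\emptyset$). **Statement.** (i) There is a universal constant $c>0$ such that for all integers $n\ge1$ and $q\ge 1$ and every (possibly partial) Boolean function $f:D\to\{0,1\}$, $D\subseteq\{0,1\}^n$, $$H_q(f)\;\ge\; c\left(\frac{\mathrm{bs}(f)}{q}+\sqrt{\mathrm{bs}(f)}\right).$$ (ii) The bound is tight for $\mathrm{Or}$: there is a universal constant $C>0$ such that for all integers $n\ge 1$ and $q\ge 1$, the total function $\mathrm{Or}_n:\{0,1\}^n\to\{0,1\}$, $\mathrm{Or}_n(x)=\bigvee_{i} x_i$, satisfies $$H_q(\mathrm{Or}_n)\;\le\; C\left(\frac{\mathrm{bs}(\mathrm{Or}_n)}{q}+\sqrt{\mathrm{bs}(\mathrm{Or}_n)}\right).$$ -/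

import Mathlib

namespace HybridQuery

open scoped Matrix

/-- Inputs `x ∈ {0,1}ⁿ`. -/
abbrev Input (n : ℕ) : Type := Fin n → Bool

/-- Labels `(i, b, z)` of the computational basis: query register `i ∈ [n]`, answer register
`b ∈ {0,1}`, and a work register of dimension `w + 1`. -/
abbrev BasisState (n w : ℕ) : Type := Fin n × Bool × Fin (w + 1)

/-- The query operator `O_x |i⟩|b⟩|z⟩ = |i⟩|b ⊕ x_i⟩|z⟩`, in coordinates (it is an involution of
the basis); see `queryOp_single`. -/
def queryOp {n w : ℕ} (x : Input n) (ψ : BasisState n w → ℝ) : BasisState n w → ℝ :=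
  fun s => ψ (s.1, xor s.2.1 (x s.1), s.2.2)

theorem queryOp_single {n w : ℕ} (x : Input n) (i : Fin n) (b : Bool) (z : Fin (w + 1)) :
    queryOp x (Pi.single (i, b, z) (1 : ℝ)) = Pi.single (i, xor b (x i), z) 1 := by
  funext s
  obtain ⟨j, c, y⟩ := s
  simp only [queryOp, Pi.single_apply, Prod.mk.injEq]
  congr 1
  apply propext
  constructor <;> rintro ⟨rfl, h, rfl⟩ <;> refine ⟨rfl, ?_, rfl⟩
  · subst h; simp
  · subst h; simp

/-- A quantum decision tree making `queries` queries: unitaries `U 0, …, U queries`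
(with real amplitudes, i.e. orthogonal matrices). -/
structure QuantumTree (n : ℕ) where
  work : ℕ
  queries : ℕ
  U : Fin (queries + 1) → Matrix.orthogonalGroup (BasisState n work) ℝ

/-- The initial state `|0⟩|0⟩|0⟩`. -/
def initState (n w : ℕ) [NeZero n] : BasisState n w → ℝ := Pi.single (0, false, 0) 1

/-- The state after `k` queries, `U_k O_x U_{k-1} O_x ⋯ O_x U_0 |0⟩|0⟩|0⟩`. -/
def QuantumTree.stateAfter {n : ℕ} [NeZero n] (A : QuantumTree n) (x : Input n)
    (k : Fin (A.queries + 1)) : BasisState n A.work → ℝ :=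
  Fin.induction (motive := fun _ => BasisState n A.work → ℝ)
    ((A.U 0).1 *ᵥ initState n A.work)
    (fun j ψ => (A.U j.succ).1 *ᵥ queryOp x ψ) k

/-- The probability that measuring the final state in the computational basis yields `s`. -/
def QuantumTree.prob {n : ℕ} [NeZero n] (A : QuantumTree n) (x : Input n)
    (s : BasisState n A.work) : ℝ :=
  (A.stateAfter x (Fin.last A.queries) s) ^ 2

/-- Hybrid decision trees: an internal node carries a quantum decision tree and has exactly one
child for each of its measurement outcomes; a leaf carries an output value. -/
inductive HybridTree (n : ℕ) : Type
  | leaf (b : Bool) : HybridTree n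
  | node (A : QuantumTree n) (child : BasisState n A.work → HybridTree n) : HybridTree n

namespace HybridTree

/-- The maximum, over root-to-leaf paths, of the total number of queries made at the nodes of the
path. -/
def cost {n : ℕ} : HybridTree n → ℕ
  | leaf _ => 0
  | node A child => A.queries + Finset.univ.sup fun s => (child s).cost

/-- Every node makes at most `q` queries. -/
def Limited {n : ℕ} (q : ℕ) : HybridTree n → Prop
  | leaf _ => True
  | node A child => A.queries ≤ q ∧ ∀ s, (child s).Limited q

/-- The probability that the tree outputs `b` on input `x`. -/
def outputProb {n : ℕ} [NeZero n] (x : Input n) (b : Bool) : HybridTree n → ℝ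
  | leaf b' => if b' = b then 1 else 0
  | node A child => ∑ s, A.prob x s * (child s).outputProb x b

/-- The tree computes the partial Boolean function `f : D → {0,1}` with bounded error. -/
def Computes {n : ℕ} [NeZero n] {D : Set (Input n)} (T : HybridTree n) (f : D → Bool) : Prop :=
  ∀ x : D, 2 / 3 ≤ T.outputProb x.1 (f x)

end HybridTree

/-- The hybrid query complexity `H_q(f)`: the minimal cost of a `q`-limited hybrid decision tree
that computes `f`. -/
noncomputable def hybridComplexity {n : ℕ} [NeZero n] {D : Set (Input n)} (q : ℕ)
    (f : D → Bool) : ℕ :=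
  sInf {c | ∃ T : HybridTree n, T.Limited q ∧ T.Computes f ∧ T.cost = c}

/-- `x` with the bits in the block `B` flipped. -/
def flipBlock {n : ℕ} (x : Input n) (B : Finset (Fin n)) : Input n :=
  fun i => if i ∈ B then !(x i) else x i

/-- `f` has `k` pairwise disjoint sensitive blocks at the point `x` of its domain: flipping any one
of the blocks leads to a point of the domain where `f` takes the other value. -/
def HasSensitiveBlocks {n : ℕ} {D : Set (Input n)} (f : D → Bool) (x : D) (k : ℕ) : Prop :=
  ∃ B : Fin k → Finset (Fin n), Pairwise (fun i j => Disjoint (B i) (B j)) ∧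
    ∀ i, ∃ h : flipBlock x.1 (B i) ∈ D, f ⟨flipBlock x.1 (B i), h⟩ ≠ f x

/-- The block sensitivity `bs(f)`, the maximal number of pairwise disjoint sensitive blocks at a
point of the domain (`0` if the domain is empty). -/
noncomputable def blockSensitivity {n : ℕ} {D : Set (Input n)} (f : D → Bool) : ℕ :=
  sSup {k | ∃ x : D, HasSensitiveBlocks f x k}

/-- The supremum in `blockSensitivity` is over a bounded set. -/
theorem HasSensitiveBlocks.le {n : ℕ} {D : Set (Input n)} {f : D → Bool} {x : D} {k : ℕ}
    (h : HasSensitiveBlocks f x k) : k ≤ n := by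
  obtain ⟨B, hd, hB⟩ := h
  have hne : ∀ i, (B i).Nonempty := by
    intro i
    by_contra hi
    rw [Finset.not_nonempty_iff_eq_empty] at hi
    obtain ⟨hm, hf⟩ := hB i
    have he : flipBlock x.1 (B i) = x.1 := by
      funext j
      simp [flipBlock, hi]
    apply hf
    congr 1
    exact Subtype.ext he
  choose g hg using hne
  have hinj : Function.Injective g := by
    intro i j hij
    by_contra hne
    exact Finset.disjoint_left.mp (hd hne) (hg i) (hij ▸ hg j)
  simpa using Fintype.card_le_of_injective g hinj

/-- The total function `Or_n`, as a function on the domain `{0,1}ⁿ`. -/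
def orFn (n : ℕ) (x : (Set.univ : Set (Input n))) : Bool := decide (∃ i, x.1 i = true)

end HybridQuery

namespace HybridQuery

open scoped Matrix

/-! ### States of quantum trees -/

namespace QuantumTree

variable {n : ℕ} [NeZero n]

/-! Lower bound: fix an input `x` with `k` disjoint sensitive blocks and compare it with each
flipped input `y`. If a node is reached with weights `P` on `x` and `Q` on `y`, give it the
potential `P Q / (P + Q)`. At the root this is `1/2`. It is superadditive, so grouping leaves by
output bit can only raise it, and correctness on both inputs bounds the grouped value by `4/9`.
Measuring two states at `ℓ²` distance `δ` lowers it by at most `2 P δ²` (`harm_le_sum_harm`), so the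
expected sum of `δ²` along the walk on `x` is at least `1/36`. This loss is weighted by
probabilities on `x` alone, so the losses for all blocks add up along one common walk. At a node
with `t` queries the hybrid argument gives `∑ δ² ≤ 4 t² ≤ 4 q t`, the sum being over blocks. Hence
`k / 36 ≤ 4 q * cost`. Since every tree is limited by its own cost, also `k ≤ 144 cost²`.

Upper bound: Grover runs with `(3 ^ j - 1) / 2` iterations, `j ≤ J`, rotate the initial angle to `3
^ j θ`. One round costs `O(3 ^ J)` and succeeds with probability at least `9 ^ J / (4 n)`; `O(n / 9
^ J)` rounds, each candidate being checked by a query, suffice. The largest `J` permitted by `q` and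
by `9 ^ J ≤ n` gives cost `O(n / q + √n)`. -/

theorem stateAfter_zero (A : QuantumTree n) (x : Input n) :
    A.stateAfter x 0 = (A.U 0).1 *ᵥ initState n A.work := rfl

theorem stateAfter_succ (A : QuantumTree n) (x : Input n) (j : Fin A.queries) :
    A.stateAfter x j.succ = (A.U j.succ).1 *ᵥ queryOp x (A.stateAfter x j.castSucc) := rfl

end QuantumTree

theorem sum_sq_orthogonal_mulVec {ι : Type*} [Fintype ι] [DecidableEq ι]
    (U : Matrix.orthogonalGroup ι ℝ) (ψ : ι → ℝ) :
    ∑ s, (U.1 *ᵥ ψ) s ^ 2 = ∑ s, ψ s ^ 2 := by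
  have h1 : ∀ φ : ι → ℝ, ∑ s, φ s ^ 2 = φ ⬝ᵥ φ := fun φ => by
    simp [dotProduct, sq]
  have h2 : U.1ᵀ * U.1 = 1 := by
    have := (Matrix.mem_orthogonalGroup_iff' ι ℝ).1 U.2
    simpa [Matrix.star_eq_conjTranspose] using this
  rw [h1, h1, Matrix.dotProduct_mulVec, Matrix.vecMul_mulVec, ← Matrix.mulVec_transpose]
  simp [h2]

theorem queryOp_sum {n w : ℕ} (x : Input n) (F : BasisState n w → ℝ) (c : Fin n → ℝ) :
    ∑ s : BasisState n w, c s.1 * F (s.1, xor s.2.1 (x s.1), s.2.2) = ∑ s, c s.1 * F s := by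
  let e : BasisState n w ≃ BasisState n w :=
    { toFun := fun s => (s.1, xor s.2.1 (x s.1), s.2.2)
      invFun := fun s => (s.1, xor s.2.1 (x s.1), s.2.2)
      left_inv := fun s => by simp
      right_inv := fun s => by simp }
  exact Equiv.sum_comp e fun s => c s.1 * F s

theorem sum_sq_queryOp {n w : ℕ} (x : Input n) (ψ : BasisState n w → ℝ) :
    ∑ s, queryOp x ψ s ^ 2 = ∑ s, ψ s ^ 2 := by
  simpa [queryOp] using queryOp_sum x (fun s => ψ s ^ 2) fun _ => 1

theorem sum_sq_initState (n w : ℕ) [NeZero n] : ∑ s, initState n w s ^ 2 = 1 := by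
  simp [initState, Pi.single_apply]

namespace QuantumTree

variable {n : ℕ} [NeZero n]

theorem sum_sq_stateAfter (A : QuantumTree n) (x : Input n) (k : Fin (A.queries + 1)) :
    ∑ s, A.stateAfter x k s ^ 2 = 1 := by
  induction k using Fin.induction with
  | zero => rw [stateAfter_zero, sum_sq_orthogonal_mulVec, sum_sq_initState]
  | succ j ih => rw [stateAfter_succ, sum_sq_orthogonal_mulVec, sum_sq_queryOp, ih]

theorem sum_prob (A : QuantumTree n) (x : Input n) : ∑ s, A.prob x s = 1 :=
  A.sum_sq_stateAfter x _

theorem prob_nonneg (A : QuantumTree n) (x : Input n) (s : BasisState n A.work) :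
    0 ≤ A.prob x s := sq_nonneg _

end QuantumTree

/-! ### The hybrid argument for disjoint blocks -/

/-- The two oracles agree outside `B`. On `B`, use `(a - b)² ≤ 2 a² + 2 b²`; each oracle permutes
the basis without changing the index, so both terms carry the same weight. -/
theorem sum_sq_queryOp_sub_flipBlock_le {n w : ℕ} (x : Input n) (B : Finset (Fin n))
    (ψ : BasisState n w → ℝ) :
    ∑ s, (queryOp x ψ s - queryOp (flipBlock x B) ψ s) ^ 2
      ≤ 4 * ∑ s, (if s.1 ∈ B then (1 : ℝ) else 0) * ψ s ^ 2 := by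
  have hx := queryOp_sum x (fun s => ψ s ^ 2) fun i => if i ∈ B then (1 : ℝ) else 0
  have hy := queryOp_sum (flipBlock x B) (fun s => ψ s ^ 2) fun i => if i ∈ B then (1 : ℝ) else 0
  have key : ∀ s : BasisState n w, (queryOp x ψ s - queryOp (flipBlock x B) ψ s) ^ 2
      ≤ 2 * ((if s.1 ∈ B then (1 : ℝ) else 0) * ψ (s.1, xor s.2.1 (x s.1), s.2.2) ^ 2)
        + 2 * ((if s.1 ∈ B then (1 : ℝ) else 0)
          * ψ (s.1, xor s.2.1 (flipBlock x B s.1), s.2.2) ^ 2) := by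
    intro s
    by_cases h : s.1 ∈ B
    · simp only [queryOp, h, if_true, one_mul]
      nlinarith [sq_nonneg (ψ (s.1, xor s.2.1 (x s.1), s.2.2)
        + ψ (s.1, xor s.2.1 (flipBlock x B s.1), s.2.2))]
    · simp [queryOp, flipBlock, h]
  refine (Finset.sum_le_sum fun s _ => key s).trans (le_of_eq ?_)
  rw [Finset.sum_add_distrib, ← Finset.mul_sum, ← Finset.mul_sum, hx, hy]
  ring

/-- Minkowski's inequality in squared form: norms `√c * k` and `√c` add up to `√c * (k + 1)`. -/
theorem sum_sq_add_le {ι : Type*} [Fintype ι] {a b : ι → ℝ} {k c : ℝ} (hk : 0 ≤ k) (hc : 0 ≤ c)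
    (ha : ∑ s, a s ^ 2 ≤ c * k ^ 2) (hb : ∑ s, b s ^ 2 ≤ c) :
    ∑ s, (a s + b s) ^ 2 ≤ c * (k + 1) ^ 2 := by
  have h1 : (∑ s, a s * b s) ^ 2 ≤ (c * k) ^ 2 := by
    refine (Finset.sum_mul_sq_le_sq_mul_sq _ a b).trans ?_
    calc (∑ s, a s ^ 2) * ∑ s, b s ^ 2 ≤ c * k ^ 2 * c := by
          gcongr
      _ = (c * k) ^ 2 := by ring
  have h2 : ∑ s, a s * b s ≤ c * k := le_of_sq_le_sq h1 (by positivity)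
  have h3 : ∑ s, (a s + b s) ^ 2
      = ∑ s, a s ^ 2 + 2 * ∑ s, a s * b s + ∑ s, b s ^ 2 := by
    rw [Finset.mul_sum, ← Finset.sum_add_distrib, ← Finset.sum_add_distrib]
    exact Finset.sum_congr rfl fun s _ => by ring
  rw [h3]
  linarith

namespace QuantumTree

variable {n : ℕ} [NeZero n]

/-- Flipping pairwise disjoint blocks moves the state after `k` queries by at most `2 k` in total,
in the `ℓ²` sense. -/
theorem sum_sq_stateAfter_sub_flipBlock_le (A : QuantumTree n) (x : Input n) {m : ℕ}
    {B : Fin m → Finset (Fin n)} (hB : Pairwise fun i j => Disjoint (B i) (B j))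
    (k : Fin (A.queries + 1)) :
    ∑ j, ∑ s, (A.stateAfter x k s - A.stateAfter (flipBlock x (B j)) k s) ^ 2
      ≤ 4 * ((k : ℕ) : ℝ) ^ 2 := by
  induction k using Fin.induction with
  | zero => simp [stateAfter_zero]
  | succ i ih =>
    set ψ := A.stateAfter x i.castSucc with hψ
    -- The new error splits into the old error, moved isometrically by the flipped oracle, and the
    -- discrepancy of the two oracles on `ψ`.
    have hstep : ∀ j, ∑ s, (A.stateAfter x i.succ s
          - A.stateAfter (flipBlock x (B j)) i.succ s) ^ 2
        = ∑ s, (queryOp (flipBlock x (B j))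
            (fun s => ψ s - A.stateAfter (flipBlock x (B j)) i.castSucc s) s
          + (queryOp x ψ s - queryOp (flipBlock x (B j)) ψ s)) ^ 2 := by
      intro j
      rw [← sum_sq_orthogonal_mulVec (A.U i.succ) fun s => queryOp (flipBlock x (B j))
            (fun s => ψ s - A.stateAfter (flipBlock x (B j)) i.castSucc s) s
          + (queryOp x ψ s - queryOp (flipBlock x (B j)) ψ s)]
      refine Finset.sum_congr rfl fun s _ => ?_
      rw [stateAfter_succ, stateAfter_succ, ← Pi.sub_apply, ← Matrix.mulVec_sub]
      congr 3
      funext s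
      simp [queryOp, hψ]
    simp only [hstep, ← Fintype.sum_prod_type']
    -- The errors for all blocks are treated as one long vector, so each query adds at most `2` to
    -- its norm, whatever the number of blocks.
    have := sum_sq_add_le (ι := Fin m × BasisState n A.work)
      (a := fun p => queryOp (flipBlock x (B p.1))
        (fun s => ψ s - A.stateAfter (flipBlock x (B p.1)) i.castSucc s) p.2)
      (b := fun p => queryOp x ψ p.2 - queryOp (flipBlock x (B p.1)) ψ p.2)
      (k := (i : ℕ)) (c := 4) (by positivity) (by norm_num) ?_ ?_
    · simpa using this
    · rw [Fintype.sum_prod_type]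
      simp only [sum_sq_queryOp]
      simpa using ih
    · rw [Fintype.sum_prod_type]
      refine (Finset.sum_le_sum fun j _ => sum_sq_queryOp_sub_flipBlock_le x (B j) ψ).trans ?_
      rw [← Finset.mul_sum, Finset.sum_comm]
      -- By disjointness an index lies in at most one block, so the block weights sum to at most
      -- `1`.
      have h1 : ∀ s : BasisState n A.work,
          ∑ j, (if s.1 ∈ B j then (1 : ℝ) else 0) * ψ s ^ 2 ≤ ψ s ^ 2 := by
        intro s
        rw [← Finset.sum_mul]
        refine mul_le_of_le_one_left (sq_nonneg _) ?_
        rw [Finset.sum_boole]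
        norm_cast
        rw [Finset.card_le_one]
        intro j hj j' hj'
        by_contra hne
        exact Finset.disjoint_left.1 (hB hne) (Finset.mem_filter.1 hj).2
          (Finset.mem_filter.1 hj').2
      have h2 := Finset.sum_le_sum fun s (_ : s ∈ Finset.univ) => h1 s
      rw [A.sum_sq_stateAfter] at h2
      linarith

end QuantumTree

/-! ### The harmonic potential -/

/-- Half the harmonic mean of two weights. -/
noncomputable def harm (a b : ℝ) : ℝ := a * b / (a + b)

theorem harm_add_harm_le {a b c d : ℝ} (ha : 0 ≤ a) (hb : 0 ≤ b) (hc : 0 ≤ c) (hd : 0 ≤ d) :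
    harm a b + harm c d ≤ harm (a + c) (b + d) := by
  unfold harm
  rcases (add_nonneg ha hb).eq_or_lt with h | h
  · obtain ⟨rfl, rfl⟩ : a = 0 ∧ b = 0 := ⟨by linarith, by linarith⟩
    simp
  rcases (add_nonneg hc hd).eq_or_lt with h' | h'
  · obtain ⟨rfl, rfl⟩ : c = 0 ∧ d = 0 := ⟨by linarith, by linarith⟩
    simp
  rw [← sub_nonneg]
  have h3 : 0 < a + c + (b + d) := by linarith
  have : (a + c) * (b + d) / (a + c + (b + d)) - (a * b / (a + b) + c * d / (c + d))
      = (a * d - b * c) ^ 2 / ((a + b) * (c + d) * (a + c + (b + d))) := by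
    field_simp
    ring
  rw [this]
  positivity

theorem sum_harm_le {ι : Type*} (t : Finset ι) {u v : ι → ℝ} (hu : ∀ i, 0 ≤ u i)
    (hv : ∀ i, 0 ≤ v i) : ∑ i ∈ t, harm (u i) (v i) ≤ harm (∑ i ∈ t, u i) (∑ i ∈ t, v i) := by
  classical
  induction t using Finset.induction_on with
  | empty => simp [harm]
  | insert i t hi ih =>
    rw [Finset.sum_insert hi, Finset.sum_insert hi, Finset.sum_insert hi]
    exact (add_le_add_right ih _).trans (harm_add_harm_le (hu i) (hv i)
      (Finset.sum_nonneg fun i _ => hu i) (Finset.sum_nonneg fun i _ => hv i))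

/-- The tangent of the potential at `(P, Q)` overestimates it by a squared amplitude difference. -/
theorem tangent_le_harm {P Q : ℝ} (hP : 0 ≤ P) (hQ : 0 ≤ Q) (a b : ℝ) :
    P * Q * (Q * a ^ 2 + P * b ^ 2) / (P + Q) ^ 2
      ≤ harm (P * a ^ 2) (Q * b ^ 2) + 2 * P * (a - b) ^ 2 := by
  unfold harm
  rcases hP.eq_or_lt with rfl | hP
  · simp
  rcases hQ.eq_or_lt with rfl | hQ
  · simp; positivity
  rcases (add_nonneg (sq_nonneg a) (sq_nonneg b)).eq_or_lt with h | h
  · have ha : a = 0 := by nlinarith [sq_nonneg a, sq_nonneg b]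
    have hb : b = 0 := by nlinarith [sq_nonneg a, sq_nonneg b]
    simp [ha, hb]
  have hden : 0 < P * a ^ 2 + Q * b ^ 2 := by
    have hm : 0 < min P Q := lt_min hP hQ
    have h1 : min P Q * a ^ 2 ≤ P * a ^ 2 := by gcongr; exact min_le_left _ _
    have h2 : min P Q * b ^ 2 ≤ Q * b ^ 2 := by gcongr; exact min_le_right _ _
    nlinarith [mul_pos hm h]
  -- The gap to the tangent is an explicit multiple of `(a² - b²)²`, which supplies the factor `(a -
  -- b)²`.
  have hid : P * Q * (Q * a ^ 2 + P * b ^ 2) / (P + Q) ^ 2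
      - P * a ^ 2 * (Q * b ^ 2) / (P * a ^ 2 + Q * b ^ 2)
      = P ^ 2 * Q ^ 2 * ((a - b) ^ 2 * (a + b) ^ 2)
        / ((P + Q) ^ 2 * (P * a ^ 2 + Q * b ^ 2)) := by
    field_simp
    ring
  have hbd : P ^ 2 * Q ^ 2 * ((a - b) ^ 2 * (a + b) ^ 2)
        / ((P + Q) ^ 2 * (P * a ^ 2 + Q * b ^ 2)) ≤ 2 * P * (a - b) ^ 2 := by
    rw [div_le_iff₀ (by positivity)]
    have h1 : (a + b) ^ 2 ≤ 2 * (a ^ 2 + b ^ 2) := by nlinarith [sq_nonneg (a - b)]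
    have h2 : P * Q ^ 2 * (a ^ 2 + b ^ 2) ≤ (P + Q) ^ 2 * (P * a ^ 2 + Q * b ^ 2) := by
      have : (P + Q) ^ 2 * (P * a ^ 2 + Q * b ^ 2) - P * Q ^ 2 * (a ^ 2 + b ^ 2)
          = (P ^ 3 + 2 * P ^ 2 * Q) * a ^ 2 + (P ^ 2 * Q + P * Q ^ 2 + Q ^ 3) * b ^ 2 := by ring
      have : 0 ≤ (P ^ 3 + 2 * P ^ 2 * Q) * a ^ 2 + (P ^ 2 * Q + P * Q ^ 2 + Q ^ 3) * b ^ 2 := by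
        positivity
      linarith
    calc P ^ 2 * Q ^ 2 * ((a - b) ^ 2 * (a + b) ^ 2)
        ≤ P ^ 2 * Q ^ 2 * ((a - b) ^ 2 * (2 * (a ^ 2 + b ^ 2))) := by gcongr
      _ = 2 * P * (a - b) ^ 2 * (P * Q ^ 2 * (a ^ 2 + b ^ 2)) := by ring
      _ ≤ 2 * P * (a - b) ^ 2 * ((P + Q) ^ 2 * (P * a ^ 2 + Q * b ^ 2)) := by gcongr
  linarith

/-- Since both vectors are normalised, the tangent values sum to the potential at `(P, Q)` itself.
It is essential that the loss involves only `P`. -/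
theorem harm_le_sum_harm {ι : Type*} [Fintype ι] {P Q : ℝ} (hP : 0 ≤ P) (hQ : 0 ≤ Q)
    {a b : ι → ℝ} (ha : ∑ s, a s ^ 2 = 1) (hb : ∑ s, b s ^ 2 = 1) :
    harm P Q ≤ ∑ s, harm (P * a s ^ 2) (Q * b s ^ 2) + 2 * P * ∑ s, (a s - b s) ^ 2 := by
  have h := Finset.sum_le_sum fun s (_ : s ∈ Finset.univ) => tangent_le_harm hP hQ (a s) (b s)
  rw [Finset.sum_add_distrib, ← Finset.mul_sum, ← Finset.sum_div, ← Finset.mul_sum,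
    Finset.sum_add_distrib, ← Finset.mul_sum, ← Finset.mul_sum, ha, hb] at h
  refine le_trans (le_of_eq ?_) h
  unfold harm
  rcases (add_nonneg hP hQ).eq_or_lt with h' | h'
  · simp [← h']
  · field_simp
    ring

/-- Equality holds at `a = 2/3`, `b = 1/3`. -/
theorem harm_add_harm_le_of_gap {a b : ℝ} (ha : 2 / 3 ≤ a) (ha' : a ≤ 1) (hb' : 0 ≤ b)
    (hb : b ≤ 1 / 3) : harm a b + harm (1 - a) (1 - b) ≤ 4 / 9 := by
  have h1 : 0 < a + b := by linarith
  have h2 : 0 < 1 - a + (1 - b) := by linarith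
  unfold harm
  rw [div_add_div _ _ h1.ne' h2.ne', div_le_iff₀ (by positivity)]
  nlinarith [mul_nonneg (sub_nonneg.2 ha) (sub_nonneg.2 hb), mul_pos h1 h2,
    sq_nonneg (a + b - 1), mul_nonneg (sub_nonneg.2 ha') hb']

/-! ### The lower bound -/

namespace HybridTree

variable {n : ℕ} [NeZero n]

theorem outputProb_nonneg (x : Input n) (b : Bool) (T : HybridTree n) :
    0 ≤ T.outputProb x b := by
  induction T with
  | leaf b' => unfold outputProb; split_ifs <;> norm_num
  | node A child ih =>
    exact Finset.sum_nonneg fun s _ => mul_nonneg (A.prob_nonneg x s) (ih s)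

theorem outputProb_not (x : Input n) (b : Bool) (T : HybridTree n) :
    T.outputProb x (!b) = 1 - T.outputProb x b := by
  induction T with
  | leaf b' => cases b <;> cases b' <;> simp [outputProb]
  | node A child ih =>
    simp only [outputProb, ih, mul_sub, mul_one, Finset.sum_sub_distrib, A.sum_prob]

theorem outputProb_le_one (x : Input n) (b : Bool) (T : HybridTree n) :
    T.outputProb x b ≤ 1 := by
  have := outputProb_nonneg x (!b) T
  rw [outputProb_not] at this
  linarith

/-- The expected total squared distance between the final states of the nodes on inputs `x` and
`y`, along the path taken on input `x`. -/
noncomputable def pathDist (x y : Input n) : HybridTree n → ℝ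
  | leaf _ => 0
  | node A child =>
    ∑ s, (A.stateAfter x (Fin.last _) s - A.stateAfter y (Fin.last _) s) ^ 2
      + ∑ s, A.prob x s * (child s).pathDist x y

theorem harm_le_outputProb_add_pathDist (x y : Input n) (b : Bool) (T : HybridTree n) {P Q : ℝ}
    (hP : 0 ≤ P) (hQ : 0 ≤ Q) :
    harm P Q ≤ harm (P * T.outputProb x b) (Q * T.outputProb y b)
      + harm (P * T.outputProb x (!b)) (Q * T.outputProb y (!b)) + 2 * P * T.pathDist x y := by
  induction T generalizing P Q with
  | leaf b' => cases b <;> cases b' <;> simp [outputProb, pathDist, harm]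
  | node A child ih =>
    have h1 := harm_le_sum_harm hP hQ (A.sum_sq_stateAfter x (Fin.last _))
      (A.sum_sq_stateAfter y (Fin.last _))
    have h2 := Finset.sum_le_sum fun s (_ : s ∈ Finset.univ) =>
      ih s (mul_nonneg hP (A.prob_nonneg x s)) (mul_nonneg hQ (A.prob_nonneg y s))
    rw [Finset.sum_add_distrib, Finset.sum_add_distrib] at h2
    -- Superadditivity merges the contributions of the children with the same output bit.
    have h3 : ∀ b', ∑ s, harm (P * A.prob x s * (child s).outputProb x b')
          (Q * A.prob y s * (child s).outputProb y b')
        ≤ harm (P * (node A child).outputProb x b') (Q * (node A child).outputProb y b') := by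
      intro b'
      refine (sum_harm_le _
        (fun s => mul_nonneg (mul_nonneg hP (A.prob_nonneg x s)) (outputProb_nonneg _ _ _))
        fun s => mul_nonneg (mul_nonneg hQ (A.prob_nonneg y s))
          (outputProb_nonneg _ _ _)).trans (le_of_eq ?_)
      simp only [outputProb, Finset.mul_sum, mul_assoc]
    have h4 : ∑ s, 2 * (P * A.prob x s) * (child s).pathDist x y
        = 2 * P * ∑ s, A.prob x s * (child s).pathDist x y := by
      rw [Finset.mul_sum]
      exact Finset.sum_congr rfl fun s _ => by ring
    have h5 := h3 b
    have h6 := h3 (!b)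
    simp only [QuantumTree.prob] at h2 h4 h5 h6
    simp only [pathDist, mul_add, QuantumTree.prob]
    linarith

/-- The potential must drop from `1/2` to at most `4/9`, and `1/18 = 2 * (1/36)`. -/
theorem le_pathDist_of_outputProb {x y : Input n} {b : Bool} {T : HybridTree n}
    (hx : 2 / 3 ≤ T.outputProb x b) (hy : 2 / 3 ≤ T.outputProb y (!b)) :
    1 / 36 ≤ T.pathDist x y := by
  have h1 := harm_le_outputProb_add_pathDist x y b T zero_le_one zero_le_one
  rw [outputProb_not] at hy
  have h2 := harm_add_harm_le_of_gap hx (outputProb_le_one x b T) (outputProb_nonneg y b T)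
    (by linarith)
  simp only [one_mul, outputProb_not] at h1
  norm_num [harm] at h1 h2
  linarith

theorem sum_pathDist_le (x : Input n) {m q : ℕ} {B : Fin m → Finset (Fin n)}
    (hB : Pairwise fun i j => Disjoint (B i) (B j)) {T : HybridTree n} (hT : T.Limited q) :
    ∑ j, T.pathDist x (flipBlock x (B j)) ≤ 4 * q * T.cost := by
  induction T with
  | leaf b => simp [pathDist, cost]
  | node A child ih =>
    simp only [pathDist, Finset.sum_add_distrib]
    have h1 := A.sum_sq_stateAfter_sub_flipBlock_le x hB (Fin.last _)
    -- The query limit turns the quadratic bound into a linear one, which adds up along paths.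
    have h2 : (4 : ℝ) * (A.queries : ℝ) ^ 2 ≤ 4 * q * A.queries := by
      have : (A.queries : ℝ) ≤ q := by exact_mod_cast hT.1
      rw [sq, ← mul_assoc]
      gcongr
    set M : ℕ := Finset.univ.sup fun s => (child s).cost with hM
    have h3 : ∑ j, ∑ s, A.prob x s * (child s).pathDist x (flipBlock x (B j)) ≤ 4 * q * M := by
      rw [Finset.sum_comm]
      calc ∑ s, ∑ j, A.prob x s * (child s).pathDist x (flipBlock x (B j))
          ≤ ∑ s, A.prob x s * (4 * q * M) := by
            refine Finset.sum_le_sum fun s _ => ?_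
            rw [← Finset.mul_sum]
            refine mul_le_mul_of_nonneg_left ((ih s (hT.2 s)).trans ?_) (A.prob_nonneg x s)
            have : ((child s).cost : ℝ) ≤ M := by
              exact_mod_cast Finset.le_sup (f := fun s => (child s).cost) (Finset.mem_univ s)
            gcongr
        _ = 4 * q * M := by rw [← Finset.sum_mul, A.sum_prob, one_mul]
    simp only [Fin.val_last] at h1
    simp only [cost]
    push_cast
    linarith

/-- Taking `q` to be the cost itself turns the bound linear in `q * cost` into the square-root
bound. -/
theorem limited_cost {n q : ℕ} {T : HybridTree n} (h : T.cost ≤ q) : T.Limited q := by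
  induction T with
  | leaf b => trivial
  | node A child ih =>
    simp only [cost] at h
    refine ⟨by omega, fun s => ih s ?_⟩
    have : (child s).cost ≤ Finset.univ.sup fun s => (child s).cost :=
      Finset.le_sup (f := fun s => (child s).cost) (Finset.mem_univ s)
    omega

theorem Computes.le_mul_cost {D : Set (Input n)} {f : D → Bool} {T : HybridTree n} {q k : ℕ}
    (hT : T.Computes f) (hq : T.Limited q) {x : D} (hk : HasSensitiveBlocks f x k) :
    (k : ℝ) ≤ 144 * q * T.cost := by
  obtain ⟨B, hB, hs⟩ := hk
  have h1 : ∀ j, 1 / 36 ≤ T.pathDist x.1 (flipBlock x.1 (B j)) := by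
    intro j
    obtain ⟨hD, hne⟩ := hs j
    refine le_pathDist_of_outputProb (hT x) ?_
    have := hT ⟨_, hD⟩
    rwa [Bool.eq_not_of_ne hne] at this
  have h2 := Finset.sum_le_sum fun j (_ : j ∈ Finset.univ) => h1 j
  have h3 := h2.trans (sum_pathDist_le x.1 hB hq)
  simp only [Finset.sum_const, Finset.card_univ, Fintype.card_fin, nsmul_eq_mul] at h3
  linarith

end HybridTree

/-! ### The lower bound in terms of block sensitivity -/

theorem exists_hasSensitiveBlocks_blockSensitivity {n : ℕ} {D : Set (Input n)} (f : D → Bool)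
    (h : 0 < blockSensitivity f) : ∃ x, HasSensitiveBlocks f x (blockSensitivity f) := by
  have hne : {k | ∃ x : D, HasSensitiveBlocks f x k}.Nonempty := by
    by_contra he
    rw [Set.not_nonempty_iff_eq_empty] at he
    rw [blockSensitivity, he] at h
    simp at h
  exact Nat.sSup_mem hne ⟨n, fun k ⟨x, hx⟩ => hx.le⟩

theorem HybridTree.Computes.blockSensitivity_le {n : ℕ} [NeZero n] {D : Set (Input n)}
    {f : D → Bool} {T : HybridTree n} {q : ℕ} (hT : T.Computes f) (hq : T.Limited q) (hq1 : 1 ≤ q) :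
    1 / 156 * ((blockSensitivity f : ℝ) / q + √(blockSensitivity f)) ≤ T.cost := by
  rcases Nat.eq_zero_or_pos (blockSensitivity f) with h0 | hpos
  · simp [h0]
  obtain ⟨x, hx⟩ := exists_hasSensitiveBlocks_blockSensitivity f hpos
  have hq0 : (0 : ℝ) < q := by exact_mod_cast hq1
  have h1 : (blockSensitivity f : ℝ) / q ≤ 144 * T.cost := by
    rw [div_le_iff₀ hq0]
    linarith [hT.le_mul_cost hq hx]
  have h2 : √(blockSensitivity f : ℝ) ≤ 12 * T.cost := by
    rw [Real.sqrt_le_left (by positivity)]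
    linarith [hT.le_mul_cost (HybridTree.limited_cost le_rfl) hx]
  linarith

end HybridQuery

namespace HybridQuery

open scoped Matrix

/-! ### Orthogonal matrices with a prescribed value -/

theorem exists_orthogonal_reflection {ι : Type*} [Fintype ι] [DecidableEq ι] (v : ι → ℝ) :
    ∃ U : Matrix.orthogonalGroup ι ℝ,
      ∀ ψ, U.1 *ᵥ ψ = fun s => ψ s - 2 * (v ⬝ᵥ ψ) / (v ⬝ᵥ v) * v s := by
  set M : Matrix ι ι ℝ := 1 - (2 / (v ⬝ᵥ v)) • Matrix.vecMulVec v v with hM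
  have hMt : Mᵀ = M := by
    simp [hM, Matrix.transpose_vecMulVec]
  have hmul : ∀ ψ, M *ᵥ ψ = fun s => ψ s - 2 * (v ⬝ᵥ ψ) / (v ⬝ᵥ v) * v s := by
    intro ψ
    funext s
    simp only [hM, Matrix.sub_mulVec, Matrix.one_mulVec, Matrix.smul_mulVec,
      Matrix.vecMulVec_mulVec, Pi.sub_apply, Pi.smul_apply, smul_eq_mul, MulOpposite.smul_eq_mul_unop,
      MulOpposite.unop_op]
    ring
  refine ⟨⟨M, ?_⟩, hmul⟩
  rw [Matrix.mem_orthogonalGroup_iff, hMt]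
  refine Matrix.ext_of_mulVec_single fun i => ?_
  rw [← Matrix.mulVec_mulVec, hmul, hmul, Matrix.one_mulVec]
  funext s
  set e : ι → ℝ := Pi.single i 1
  -- Division by zero makes the map the identity when `v = 0`.
  rcases eq_or_ne (v ⬝ᵥ v) 0 with h0 | h0
  · simp [h0]
  have : (v ⬝ᵥ fun s => e s - 2 * (v ⬝ᵥ e) / (v ⬝ᵥ v) * v s) = - (v ⬝ᵥ e) := by
    have h1 : (fun s => e s - 2 * (v ⬝ᵥ e) / (v ⬝ᵥ v) * v s)
        = e - (2 * (v ⬝ᵥ e) / (v ⬝ᵥ v)) • v := rfl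
    rw [h1, dotProduct_sub, dotProduct_smul, smul_eq_mul]
    field_simp
    ring
  rw [this]
  ring

/-- The reflection in the hyperplane orthogonal to `u - v` exchanges unit vectors `u` and `v`. -/
theorem exists_orthogonal_mulVec_eq {ι : Type*} [Fintype ι] [DecidableEq ι] {u v : ι → ℝ}
    (hu : ∑ s, u s ^ 2 = 1) (hv : ∑ s, v s ^ 2 = 1) :
    ∃ U : Matrix.orthogonalGroup ι ℝ, U.1 *ᵥ u = v := by
  obtain ⟨U, hU⟩ := exists_orthogonal_reflection (u - v)
  refine ⟨U, ?_⟩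
  have hu' : u ⬝ᵥ u = 1 := by simpa [dotProduct, sq] using hu
  have hv' : v ⬝ᵥ v = 1 := by simpa [dotProduct, sq] using hv
  rw [hU]
  have h1 : (u - v) ⬝ᵥ u = 1 - u ⬝ᵥ v := by
    rw [sub_dotProduct, hu', dotProduct_comm v u]
  have h2 : (u - v) ⬝ᵥ (u - v) = 2 * (1 - u ⬝ᵥ v) := by
    rw [dotProduct_sub, h1, sub_dotProduct, hv']
    ring
  funext s
  rw [h1, h2]
  rcases eq_or_ne (1 - u ⬝ᵥ v) 0 with h0 | h0
  · rw [h0, mul_zero, dotProduct_self_eq_zero] at h2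
    rw [h0, sub_eq_zero.1 h2]
    simp
  · rw [div_self (by simpa using h0)]
    simp

theorem exists_orthogonal_reflection_of_unit {ι : Type*} [Fintype ι] [DecidableEq ι] {u : ι → ℝ}
    (hu : ∑ s, u s ^ 2 = 1) :
    ∃ U : Matrix.orthogonalGroup ι ℝ, ∀ ψ, U.1 *ᵥ ψ = fun s => 2 * (u ⬝ᵥ ψ) * u s - ψ s := by
  obtain ⟨U, hU⟩ := exists_orthogonal_reflection u
  refine ⟨-U, fun ψ => ?_⟩
  have hu' : u ⬝ᵥ u = 1 := by simpa [dotProduct, sq] using hu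
  funext s
  have : (-U : Matrix.orthogonalGroup ι ℝ).1 = -U.1 := rfl
  rw [this, Matrix.neg_mulVec, hU, Pi.neg_apply, hu']
  ring

/-! ### Reading a single bit -/

variable {n : ℕ} [NeZero n]

theorem exists_readBit (i : Fin n) :
    ∃ A : QuantumTree n, A.queries = 1 ∧ ∀ (x : Input n) (F : Bool → ℝ),
      ∑ s, A.prob x s * F s.2.1 = F (x i) := by
  obtain ⟨U, hU⟩ := exists_orthogonal_mulVec_eq (sum_sq_initState n 0)
    (v := Pi.single (i, false, 0) 1) (by simp [Pi.single_apply])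
  refine ⟨⟨0, 1, ![U, 1]⟩, rfl, fun x F => ?_⟩
  have hstate : (⟨0, 1, ![U, 1]⟩ : QuantumTree n).stateAfter x (Fin.last 1)
      = Pi.single (i, x i, 0) 1 := by
    change (1 : Matrix (BasisState n 0) (BasisState n 0) ℝ) *ᵥ
      queryOp x (U.1 *ᵥ initState n 0) = _
    rw [hU, queryOp_single, Matrix.one_mulVec, Bool.false_xor]
  unfold QuantumTree.prob
  rw [hstate]
  rw [Finset.sum_eq_single (i, x i, 0)]
  · simp
  · intro s _ hs
    rw [Pi.single_eq_of_ne hs]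
    simp
  · simp

/-- The one-query tree that reads the bit `i`. -/
noncomputable def readBit (i : Fin n) : QuantumTree n := (exists_readBit i).choose

theorem readBit_queries (i : Fin n) : (readBit i).queries = 1 := (exists_readBit i).choose_spec.1

theorem sum_readBit_prob (i : Fin n) (x : Input n) (F : Bool → ℝ) :
    ∑ s, (readBit i).prob x s * F s.2.1 = F (x i) := (exists_readBit i).choose_spec.2 x F

/-- The tree that reads the bits in a list, records them in `y`, and then outputs `g y`. -/
noncomputable def readTree (g : Input n → Bool) : List (Fin n) → Input n → HybridTree n
  | [], y => .leaf (g y)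
  | i :: l, y => .node (readBit i) fun s => readTree g l (Function.update y i s.2.1)

theorem readTree_limited (g : Input n → Bool) {q : ℕ} (hq : 1 ≤ q) (l : List (Fin n))
    (y : Input n) : (readTree g l y).Limited q := by
  induction l generalizing y with
  | nil => trivial
  | cons i l ih => exact ⟨(readBit_queries i).trans_le hq, fun s => ih _⟩

theorem readTree_outputProb (g : Input n → Bool) (x : Input n) (b : Bool) (l : List (Fin n))
    (y : Input n) (h : ∀ i ∉ l, y i = x i) :
    (readTree g l y).outputProb x b = if g x = b then 1 else 0 := by
  induction l generalizing y with
  | nil =>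
    obtain rfl : y = x := funext fun i => h i (by simp)
    rfl
  | cons i l ih =>
    simp only [readTree, HybridTree.outputProb]
    rw [sum_readBit_prob i x fun c => (readTree g l (Function.update y i c)).outputProb x b]
    refine ih _ fun j hj => ?_
    rcases eq_or_ne j i with rfl | hji
    · simp
    · rw [Function.update_of_ne hji]
      exact h j (by simp [hji, hj])

/-- Reading every bit works. This is needed because `sInf ∅ = 0` would otherwise make the lower
bound fail. -/
theorem exists_limited_computes {D : Set (Input n)} (f : D → Bool) {q : ℕ} (hq : 1 ≤ q) :
    ∃ T : HybridTree n, T.Limited q ∧ T.Computes f := by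
  classical
  refine ⟨readTree (fun y => if h : y ∈ D then f ⟨y, h⟩ else false) (List.finRange n)
    fun _ => false, readTree_limited _ hq _ _, fun x => ?_⟩
  rw [readTree_outputProb _ _ _ _ _ fun i hi => absurd (List.mem_finRange i) hi]
  norm_num

theorem le_hybridComplexity {D : Set (Input n)} (f : D → Bool) {q : ℕ} (hq : 1 ≤ q) :
    1 / 156 * ((blockSensitivity f : ℝ) / q + √(blockSensitivity f)) ≤ hybridComplexity q f := by
  obtain ⟨T, hT, hc⟩ := exists_limited_computes f hq
  obtain ⟨T', hT', hc', hcost⟩ : hybridComplexity q f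
      ∈ {c | ∃ T : HybridTree n, T.Limited q ∧ T.Computes f ∧ T.cost = c} :=
    Nat.sInf_mem ⟨_, T, hT, hc, rfl⟩
  rw [← hcost]
  exact hc'.blockSensitivity_le hT' hq

/-! ### Grover iterations -/

/-- The uniform superposition, with the answer register in the state `(|0⟩ - |1⟩) / √2`. -/
noncomputable def uniformState (n : ℕ) (s : BasisState n 0) : ℝ :=
  (if s.2.1 then -1 else 1) * (√(2 * n))⁻¹

theorem sq_uniformState {n : ℕ} (s : BasisState n 0) : uniformState n s ^ 2 = (2 * n : ℝ)⁻¹ := by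
  unfold uniformState
  rw [mul_pow, inv_pow, Real.sq_sqrt (by positivity)]
  split_ifs <;> simp

theorem sum_sq_uniformState_mul (c : Fin n → ℝ) :
    ∑ s, uniformState n s ^ 2 * c s.1 = (∑ i, c i) / n := by
  have hn : (n : ℝ) ≠ 0 := NeZero.ne _
  simp only [sq_uniformState, ← Finset.mul_sum, Fintype.sum_prod_type, Finset.sum_const,
    Finset.card_univ, nsmul_eq_mul]
  simp only [Finset.mul_sum, Finset.sum_div]
  refine Finset.sum_congr rfl fun i _ => ?_
  simp only [Fintype.card_prod, Fintype.card_bool, Fintype.card_fin]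
  push_cast
  field_simp

theorem sum_sq_uniformState : ∑ s, uniformState n s ^ 2 = 1 := by
  have hn : (n : ℝ) ≠ 0 := NeZero.ne _
  simpa [hn] using sum_sq_uniformState_mul (n := n) fun _ => 1

/-- The fraction of the bits of `x` that are `1`. -/
noncomputable def density {n : ℕ} (x : Input n) : ℝ := (∑ i, if x i then (1 : ℝ) else 0) / n

theorem density_le_one (x : Input n) : density x ≤ 1 := by
  have hn : (0 : ℝ) < n := by exact_mod_cast NeZero.pos n
  rw [density, div_le_one hn]
  calc (∑ i, if x i then (1 : ℝ) else 0) ≤ ∑ _i : Fin n, (1 : ℝ) :=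
        Finset.sum_le_sum fun i _ => by split_ifs <;> norm_num
    _ = n := by simp

theorem inv_le_density {n : ℕ} {x : Input n} (h : ∃ i, x i = true) : (n : ℝ)⁻¹ ≤ density x := by
  obtain ⟨i, hi⟩ := h
  rw [density, ← one_div]
  gcongr
  calc (1 : ℝ) = if x i then 1 else 0 := by simp [hi]
    _ ≤ _ := Finset.single_le_sum (f := fun i => if x i then (1 : ℝ) else 0)
      (fun i _ => by split_ifs <;> norm_num) (Finset.mem_univ i)

/-- The state with amplitude `α` (times uniform) on the marked and `β` on the unmarked items. -/
noncomputable def markedState {n : ℕ} (x : Input n) (α β : ℝ) (s : BasisState n 0) : ℝ :=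
  (if x s.1 then α else β) * uniformState n s

/-- Phase kickback: flipping the answer bit negates its state `(|0⟩ - |1⟩) / √2`. -/
theorem queryOp_markedState {n : ℕ} (x : Input n) (α β : ℝ) :
    queryOp x (markedState x α β) = markedState x (-α) β := by
  funext ⟨i, b, z⟩
  cases h : x i <;> cases b <;> simp [queryOp, markedState, uniformState, h]

theorem uniformState_dotProduct_markedState (x : Input n) (α β : ℝ) :
    uniformState n ⬝ᵥ markedState x α β = α * density x + β * (1 - density x) := by
  have h1 := sum_sq_uniformState_mul (n := n) fun i => if x i then α else β
  have h2 : ∀ i, (if x i then α else β) = (α - β) * (if x i then (1 : ℝ) else 0) + β := by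
    intro i; split_ifs <;> ring
  have hn : (n : ℝ) ≠ 0 := NeZero.ne _
  have h3 : (∑ i, if x i then α else β) / (n : ℝ) = (α - β) * density x + β := by
    simp only [h2, Finset.sum_add_distrib, ← Finset.mul_sum, density]
    simp
    field_simp
  rw [h3] at h1
  calc uniformState n ⬝ᵥ markedState x α β
      = ∑ s, uniformState n s ^ 2 * (if x s.1 then α else β) :=
        Finset.sum_congr rfl fun s _ => by rw [markedState]; ring
    _ = _ := by rw [h1]; ring

theorem exists_grover (n : ℕ) [NeZero n] (k : ℕ) :
    ∃ A : QuantumTree n, A.queries = k ∧ ∀ (x : Input n) (θ : ℝ), Real.sin θ ^ 2 = density x →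
      ∑ s, A.prob x s * (if x s.1 then 0 else 1) = 1 - Real.sin ((2 * k + 1) * θ) ^ 2 := by
  obtain ⟨V, hV⟩ := exists_orthogonal_mulVec_eq (sum_sq_initState n 0)
    (sum_sq_uniformState (n := n))
  obtain ⟨R, hR⟩ := exists_orthogonal_reflection_of_unit (sum_sq_uniformState (n := n))
  let A : QuantumTree n := ⟨0, k, Fin.cons V fun _ => R⟩
  refine ⟨A, rfl, fun x θ hθ => ?_⟩
  have hcos : Real.cos θ ^ 2 = 1 - density x := by rw [← hθ, Real.cos_sq']
  -- The products `α * sin θ` and `β * cos θ` are tracked, not quotients, so that densities `0` and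
  -- `1` need no separate case.
  have hinv : ∀ j : Fin (k + 1), ∃ α β : ℝ, A.stateAfter x j = markedState x α β ∧
      α * Real.sin θ = Real.sin ((2 * (j : ℕ) + 1) * θ) ∧
      β * Real.cos θ = Real.cos ((2 * (j : ℕ) + 1) * θ) := by
    intro j
    induction j using Fin.induction with
    | zero =>
      refine ⟨1, 1, ?_, by simp, by simp⟩
      refine (A.stateAfter_zero x).trans (hV.trans ?_)
      funext s
      simp [markedState]
    | succ i ih =>
      obtain ⟨α, β, hs, hα, hβ⟩ := ih
      refine ⟨α * (1 - 2 * density x) + 2 * (1 - density x) * β,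
        -2 * density x * α + (1 - 2 * density x) * β, ?_, ?_, ?_⟩
      · refine (A.stateAfter_succ x i).trans ?_
        rw [hs, queryOp_markedState]
        refine (hR _).trans ?_
        rw [uniformState_dotProduct_markedState]
        funext s
        simp only [markedState]
        split_ifs <;> ring
      all_goals
        have harg : (2 * ((i.succ : Fin (k + 1)) : ℕ) + 1 : ℝ) * θ
            = (2 * ((i.castSucc : Fin (k + 1)) : ℕ) + 1) * θ + 2 * θ := by
          simp; ring
        rw [harg]
      · rw [Real.sin_add, Real.sin_two_mul, Real.cos_two_mul, ← hα, ← hβ, hcos]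
        linear_combination (-2 * Real.sin θ * β) * hcos
      · rw [Real.cos_add, Real.sin_two_mul, Real.cos_two_mul, ← hα, ← hβ, hcos]
        linear_combination (2 * Real.cos θ * α) * hθ
  obtain ⟨α, β, hs, hα, hβ⟩ := hinv (Fin.last k)
  have h1 : ∑ s, A.prob x s * (if x s.1 then 0 else 1)
      = ∑ s, uniformState n s ^ 2 * (if x s.1 then 0 else β ^ 2) := by
    refine Finset.sum_congr rfl fun s _ => ?_
    have : A.prob x s = markedState x α β s ^ 2 := congrArg (· ^ 2) (congrFun hs s)
    rw [this, markedState]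
    split_ifs <;> ring
  have hn : (n : ℝ) ≠ 0 := NeZero.ne _
  have h2 : ∀ i, (if x i then 0 else β ^ 2) = β ^ 2 - β ^ 2 * (if x i then (1 : ℝ) else 0) := by
    intro i; split_ifs <;> ring
  have h3 : (∑ i, if x i then 0 else β ^ 2) / (n : ℝ) = β ^ 2 * (1 - density x) := by
    simp only [h2, Finset.sum_sub_distrib, ← Finset.mul_sum, density]
    simp
    field_simp
  rw [h1, sum_sq_uniformState_mul fun i => if x i then 0 else β ^ 2, h3, ← hcos, ← mul_pow, hβ, Real.cos_sq']
  simp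

/-- Grover search with `k` iterations. -/
noncomputable def grover (n : ℕ) [NeZero n] (k : ℕ) : QuantumTree n := (exists_grover n k).choose

theorem grover_queries (k : ℕ) : (grover n k).queries = k := (exists_grover n k).choose_spec.1

theorem sum_grover_prob (k : ℕ) {x : Input n} {θ : ℝ} (hθ : Real.sin θ ^ 2 = density x) :
    ∑ s, (grover n k).prob x s * (if x s.1 then 0 else 1) = 1 - Real.sin ((2 * k + 1) * θ) ^ 2 :=
  (exists_grover n k).choose_spec.2 x θ hθ

/-- The tree that runs Grover search for each number of iterations in a list, checks the item
found, and outputs `true` as soon as a marked item is found. -/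
noncomputable def searchTree (n : ℕ) [NeZero n] : List ℕ → HybridTree n
  | [] => .leaf false
  | k :: l => .node (grover n k) fun s =>
      .node (readBit s.1) fun s' => if s'.2.1 then .leaf true else searchTree n l

theorem searchTree_limited {q : ℕ} (hq : 1 ≤ q) {l : List ℕ} (hl : ∀ k ∈ l, k ≤ q) :
    (searchTree n l).Limited q := by
  induction l with
  | nil => trivial
  | cons k l ih =>
    refine ⟨(grover_queries k).trans_le (hl k (by simp)), fun s =>
      ⟨(readBit_queries _).trans_le hq, fun s' => ?_⟩⟩
    cases h : s'.2.1
    · simpa [h] using ih fun k hk => hl k (by simp [hk])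
    · simp [h, HybridTree.Limited]

theorem searchTree_cost_le (l : List ℕ) :
    (searchTree n l).cost ≤ (l.map (· + 1)).sum := by
  induction l with
  | nil => simp [searchTree, HybridTree.cost]
  | cons k l ih =>
    simp only [searchTree, HybridTree.cost, grover_queries, readBit_queries, List.map_cons,
      List.sum_cons, add_assoc]
    gcongr
    refine Finset.sup_le fun s _ => ?_
    gcongr
    refine Finset.sup_le fun s' _ => ?_
    split_ifs
    · simp [HybridTree.cost]
    · exact ih

theorem searchTree_outputProb_false_cons (k : ℕ) (l : List ℕ) (x : Input n) :
    (searchTree n (k :: l)).outputProb x false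
      = (∑ s, (grover n k).prob x s * (if x s.1 then 0 else 1))
        * (searchTree n l).outputProb x false := by
  simp only [searchTree, HybridTree.outputProb]
  rw [Finset.sum_mul]
  refine Finset.sum_congr rfl fun s _ => ?_
  rw [sum_readBit_prob s.1 x fun c =>
    (if c = true then HybridTree.leaf true else searchTree n l).outputProb x false]
  split_ifs <;> simp [HybridTree.outputProb]

/-- The error is one-sided: a candidate is accepted only after its bit has been read. -/
theorem searchTree_outputProb_false_of_zero {x : Input n} (hx : ∀ i, x i = false) (l : List ℕ) :
    (searchTree n l).outputProb x false = 1 := by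
  induction l with
  | nil => simp [searchTree, HybridTree.outputProb]
  | cons k l ih => simp [searchTree_outputProb_false_cons, ih, hx, (grover n k).sum_prob]

theorem searchTree_outputProb_false {x : Input n} {θ : ℝ} (hθ : Real.sin θ ^ 2 = density x)
    (l : List ℕ) : (searchTree n l).outputProb x false
      = (l.map fun k : ℕ => 1 - Real.sin ((2 * k + 1) * θ) ^ 2).prod := by
  induction l with
  | nil => simp [searchTree, HybridTree.outputProb]
  | cons k l ih =>
    rw [searchTree_outputProb_false_cons, ih, sum_grover_prob k hθ, List.map_cons, List.prod_cons]

end HybridQuery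

namespace HybridQuery

variable {n : ℕ} [NeZero n]

/-! ### The search schedule -/

theorem prod_le_of_mem {l : List ℝ} (h0 : ∀ a ∈ l, 0 ≤ a) (h1 : ∀ a ∈ l, a ≤ 1) {a : ℝ}
    (ha : a ∈ l) : l.prod ≤ a := by
  induction l generalizing a with
  | nil => simp at ha
  | cons b l ih =>
    simp only [List.mem_cons, forall_eq_or_imp] at h0 h1
    have hl0 : 0 ≤ l.prod := List.prod_nonneg h0.2
    rw [List.prod_cons]
    rcases List.mem_cons.1 ha with rfl | ha
    · refine mul_le_of_le_one_right h0.1 ?_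
      rcases l with _ | ⟨c, l⟩
      · simp
      · exact (ih h0.2 h1.2 List.mem_cons_self).trans (h1.2 c List.mem_cons_self)
    · exact (mul_le_of_le_one_left hl0 h1.1).trans (ih h0.2 h1.2 ha)

/-- One of the angles `3 ^ j * θ` with `j ≤ J` has a large sine. -/
theorem exists_le_sin_three_pow_sq {θ : ℝ} (h0 : 0 ≤ θ) (h1 : θ ≤ Real.pi / 2) (J : ℕ) :
    ∃ j ≤ J, min (1 / 4) (9 ^ J / 4 * Real.sin θ ^ 2) ≤ Real.sin (3 ^ j * θ) ^ 2 := by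
  have hhalf : ∀ t : ℝ, Real.pi / 6 ≤ t → t ≤ Real.pi / 2 → 1 / 4 ≤ Real.sin t ^ 2 := by
    intro t ht ht'
    have : 1 / 2 ≤ Real.sin t := by
      rw [← Real.sin_pi_div_six]
      exact Real.sin_le_sin_of_le_of_le_pi_div_two (by linarith [Real.pi_pos]) ht' ht
    nlinarith
  -- Tripling an angle below `π / 6` cannot overshoot `π / 2`, so the first angle above `π / 6` has
  -- sine at least `1/2`.
  have hJ : (∃ j ≤ J, 1 / 4 ≤ Real.sin (3 ^ j * θ) ^ 2) ∨ 3 ^ J * θ ≤ Real.pi / 6 := by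
    induction J with
    | zero =>
      rcases le_total θ (Real.pi / 6) with h | h
      · exact Or.inr (by simpa using h)
      · exact Or.inl ⟨0, le_rfl, by simpa using hhalf θ h h1⟩
    | succ J ih =>
      rcases ih with ⟨j, hj, h⟩ | h
      · exact Or.inl ⟨j, by omega, h⟩
      rcases le_total (3 ^ (J + 1) * θ) (Real.pi / 6) with h' | h'
      · exact Or.inr h'
      · refine Or.inl ⟨J + 1, le_rfl, hhalf _ h' ?_⟩
        rw [pow_succ]
        linarith
  rcases hJ with ⟨j, hj, h⟩ | h
  · exact ⟨j, hj, (min_le_left _ _).trans h⟩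
  · refine ⟨J, le_rfl, (min_le_right _ _).trans ?_⟩
    have hs0 : 0 ≤ Real.sin θ := Real.sin_nonneg_of_nonneg_of_le_pi h0 (by linarith [Real.pi_pos])
    have h2 : 1 / 2 * (3 ^ J * Real.sin θ) ≤ Real.sin (3 ^ J * θ) := by
      refine le_trans ?_ (Real.mul_le_sin (by positivity) (by linarith [Real.pi_pos]))
      have hpi : 1 / 2 ≤ 2 / Real.pi := by
        rw [div_le_div_iff₀ two_pos Real.pi_pos]
        linarith [Real.pi_le_four]
      have := Real.sin_le h0
      gcongr
    have h3 : (9 : ℝ) ^ J = (3 ^ J) ^ 2 := by rw [← pow_mul, mul_comm, pow_mul]; norm_num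
    calc 9 ^ J / 4 * Real.sin θ ^ 2 = (1 / 2 * (3 ^ J * Real.sin θ)) ^ 2 := by rw [h3]; ring
      _ ≤ _ := by gcongr

/-- The numbers of iterations `(3 ^ j - 1) / 2` with `j ≤ J`. -/
def schedule (J : ℕ) : List ℕ := (List.range (J + 1)).map fun j => (3 ^ j - 1) / 2

theorem two_mul_schedule_add_one (j : ℕ) : 2 * ((3 ^ j - 1) / 2) + 1 = 3 ^ j := by
  have h : Odd (3 ^ j) := Odd.pow (by decide)
  obtain ⟨m, hm⟩ := h
  omega

theorem le_of_mem_schedule {J q : ℕ} (h : 3 ^ J ≤ 2 * q + 1) {k : ℕ} (hk : k ∈ schedule J) :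
    k ≤ q := by
  simp only [schedule, List.mem_map, List.mem_range] at hk
  obtain ⟨j, hj, rfl⟩ := hk
  have : 3 ^ j ≤ 3 ^ J := Nat.pow_le_pow_right (by norm_num) (by omega)
  omega

/-- A geometric sum in which the last run dominates, the `+ 1` counting the check after each run. -/
theorem two_mul_sum_schedule_le (J : ℕ) : 2 * ((schedule J).map (· + 1)).sum ≤ 3 * 3 ^ J := by
  induction J with
  | zero => simp [schedule]
  | succ J ih =>
    have h1 : ((schedule (J + 1)).map (· + 1)).sum
        = ((schedule J).map (· + 1)).sum + ((3 ^ (J + 1) - 1) / 2 + 1) := by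
      simp [schedule, List.range_succ, add_assoc]
    have h2 := two_mul_schedule_add_one (J + 1)
    have h3 : 3 ^ (J + 1) = 3 * 3 ^ J := by ring
    have h4 : 0 < 3 ^ J := by positivity
    omega

/-- One round of the schedule fails to find a marked item with probability at most
`1 - 9 ^ J / (4 n)`. -/
theorem prod_schedule_le {x : Input n} (hx : ∃ i, x i = true) {θ : ℝ} (h0 : 0 ≤ θ)
    (h1 : θ ≤ Real.pi / 2) (hθ : Real.sin θ ^ 2 = density x) {J : ℕ} (hJ : 9 ^ J ≤ n) :
    ((schedule J).map fun k : ℕ => (1 : ℝ) - Real.sin ((2 * k + 1) * θ) ^ 2).prod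
      ≤ 1 - 9 ^ J / (4 * (n : ℝ)) := by
  obtain ⟨j, hj, hsin⟩ := exists_le_sin_three_pow_sq h0 h1 J
  have hn : (0 : ℝ) < n := by exact_mod_cast NeZero.pos n
  have hJ' : (9 : ℝ) ^ J ≤ n := by exact_mod_cast hJ
  have hle : (9 : ℝ) ^ J / (4 * n) ≤ Real.sin (3 ^ j * θ) ^ 2 := by
    refine le_trans (le_min ?_ ?_) hsin
    · rw [div_le_div_iff₀ (by positivity) (by norm_num)]
      linarith
    · rw [hθ]
      calc (9 : ℝ) ^ J / (4 * n) = 9 ^ J / 4 * (n : ℝ)⁻¹ := by field_simp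
        _ ≤ 9 ^ J / 4 * density x := by gcongr; exact inv_le_density hx
  have hmem : 1 - Real.sin (3 ^ j * θ) ^ 2
      ∈ (schedule J).map fun k : ℕ => 1 - Real.sin ((2 * k + 1) * θ) ^ 2 := by
    refine List.mem_map.2 ⟨(3 ^ j - 1) / 2,
      List.mem_map.2 ⟨j, List.mem_range.2 (by omega), rfl⟩, ?_⟩
    have : (2 * (((3 ^ j - 1) / 2 : ℕ) : ℝ) + 1) = 3 ^ j := by
      exact_mod_cast two_mul_schedule_add_one j
    rw [this]
  refine (prod_le_of_mem ?_ ?_ hmem).trans (by linarith)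
  · intro a ha
    obtain ⟨k, -, rfl⟩ := List.mem_map.1 ha
    linarith [Real.sin_sq_le_one ((2 * k + 1) * θ)]
  · intro a ha
    obtain ⟨k, -, rfl⟩ := List.mem_map.1 ha
    linarith [sq_nonneg (Real.sin ((2 * k + 1) * θ))]

theorem searchTree_computes_orFn {J R : ℕ} (hJ : 9 ^ J ≤ n) (hR : 8 * n / 9 ^ J ≤ (R : ℝ)) :
    (searchTree n (List.replicate R (schedule J)).flatten).Computes (orFn n) := by
  rintro ⟨x, -⟩
  by_cases hx : ∃ i, x i = true
  · have hor : orFn n ⟨x, trivial⟩ = !false := by simpa [orFn] using hx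
    have hn : (0 : ℝ) < n := by exact_mod_cast NeZero.pos n
    have hd0 : 0 ≤ density x := (inv_nonneg.2 hn.le).trans (inv_le_density hx)
    set θ := Real.arcsin √(density x)
    have hθ : Real.sin θ ^ 2 = density x := by
      rw [Real.sin_arcsin (by linarith [Real.sqrt_nonneg (density x)])
        (Real.sqrt_le_one.2 (density_le_one x)), Real.sq_sqrt hd0]
    have hround := prod_schedule_le hx (Real.arcsin_nonneg.2 (Real.sqrt_nonneg _))
      (Real.arcsin_le_pi_div_two _) hθ hJ
    set p := ((schedule J).map fun k : ℕ => 1 - Real.sin ((2 * k + 1) * θ) ^ 2).prod with hp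
    have hp0 : 0 ≤ p := by
      refine List.prod_nonneg fun a ha => ?_
      obtain ⟨k, -, rfl⟩ := List.mem_map.1 ha
      linarith [Real.sin_sq_le_one ((2 * k + 1) * θ)]
    rw [hor, HybridTree.outputProb_not, searchTree_outputProb_false hθ, List.map_flatten,
      List.prod_flatten, List.map_map, List.map_replicate, List.prod_replicate]
    change 2 / 3 ≤ 1 - p ^ R
    have h1 : p ≤ Real.exp (-(9 ^ J / (4 * n))) :=
      hround.trans (by linarith [Real.add_one_le_exp (-((9 : ℝ) ^ J / (4 * n)))])
    -- The factor `8` in the number of rounds makes the exponent `R * 9 ^ J / (4 n)` at least `2`,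
    -- and `e² ≥ 3`.
    have h2 : p ^ R ≤ Real.exp (-2) := by
      calc p ^ R ≤ Real.exp (-(9 ^ J / (4 * n))) ^ R := by gcongr
        _ = Real.exp (R * -(9 ^ J / (4 * n))) := by rw [← Real.exp_nat_mul]
        _ ≤ Real.exp (-2) := by
          rw [Real.exp_le_exp]
          rw [div_le_iff₀ (by positivity)] at hR
          have : 2 ≤ (R : ℝ) * (9 ^ J / (4 * n)) := by
            rw [← mul_div_assoc, le_div_iff₀ (by positivity)]
            linarith
          linarith
    have h3 : Real.exp (-2) ≤ 1 / 3 := by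
      rw [Real.exp_neg, ← one_div]
      gcongr
      linarith [Real.add_one_le_exp (2 : ℝ)]
    linarith
  · have hor : orFn n ⟨x, trivial⟩ = false := by simpa [orFn] using hx
    rw [hor, searchTree_outputProb_false_of_zero (by simpa using hx)]
    norm_num

/-! ### The upper bound for `Or` -/

/-- All singletons are sensitive at the zero input. Only this inequality is needed, the upper bound
being monotone in block sensitivity. -/
theorem le_blockSensitivity_orFn (n : ℕ) : n ≤ blockSensitivity (orFn n) := by
  refine le_csSup ⟨n, fun k ⟨x, hx⟩ => hx.le⟩ ⟨⟨fun _ => false, trivial⟩, fun i => {i}, ?_, ?_⟩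
  · intro i j hij
    simpa using hij
  · intro i
    refine ⟨trivial, ?_⟩
    simp [orFn, flipBlock]

theorem exists_schedule_length (n : ℕ) [NeZero n] (q : ℕ) :
    ∃ J, (3 ^ J ≤ 2 * q + 1 ∧ 9 ^ J ≤ n) ∧ ¬(3 ^ (J + 1) ≤ 2 * q + 1 ∧ 9 ^ (J + 1) ≤ n) := by
  by_contra! h
  have hall : ∀ J, 3 ^ J ≤ 2 * q + 1 ∧ 9 ^ J ≤ n := by
    intro J
    induction J with
    | zero => exact ⟨by simp, by simpa using NeZero.one_le⟩
    | succ J ih => exact h J ih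
  exact absurd (hall n).2 (not_le.2 (Nat.lt_pow_self (by norm_num)))

theorem hybridComplexity_orFn_le (n : ℕ) [NeZero n] {q : ℕ} (hq : 1 ≤ q) :
    (hybridComplexity q (orFn n) : ℝ) ≤ 45 * ((n : ℝ) / q + √n) := by
  obtain ⟨J, ⟨hJq, hJn⟩, hJ⟩ := exists_schedule_length n q
  set R := ⌈8 * (n : ℝ) / 9 ^ J⌉₊ with hR
  set l := (List.replicate R (schedule J)).flatten with hl
  have hcomp : (searchTree n l).Computes (orFn n) := searchTree_computes_orFn hJn (Nat.le_ceil _)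
  have hlim : (searchTree n l).Limited q := by
    refine searchTree_limited hq fun k hk => ?_
    obtain ⟨l', hl', hk'⟩ := List.mem_flatten.1 hk
    rw [List.eq_of_mem_replicate hl'] at hk'
    exact le_of_mem_schedule hJq hk'
  have hcost : 2 * (searchTree n l).cost ≤ R * (3 * 3 ^ J) := by
    have h1 := searchTree_cost_le (n := n) l
    have h2 : (l.map (· + 1)).sum = R * ((schedule J).map (· + 1)).sum := by
      rw [hl, List.map_flatten, List.sum_flatten, List.map_map, List.map_replicate,
        List.sum_replicate, smul_eq_mul]
      rfl
    calc 2 * (searchTree n l).cost ≤ 2 * (R * ((schedule J).map (· + 1)).sum) := by omega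
      _ = R * (2 * ((schedule J).map (· + 1)).sum) := by ring
      _ ≤ _ := Nat.mul_le_mul_left _ (two_mul_sum_schedule_le J)
  have hH : hybridComplexity q (orFn n) ≤ (searchTree n l).cost :=
    Nat.sInf_le ⟨_, hlim, hcomp, rfl⟩
  have hHR : 2 * (hybridComplexity q (orFn n) : ℝ) ≤ R * (3 * 3 ^ J) := by
    exact_mod_cast (Nat.mul_le_mul_left 2 hH).trans hcost
  have hn : (0 : ℝ) < n := by exact_mod_cast NeZero.pos n
  have hq0 : (0 : ℝ) < q := by exact_mod_cast hq
  have h9 : (9 : ℝ) ^ J = (3 ^ J) ^ 2 := by rw [← pow_mul, mul_comm, pow_mul]; norm_num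
  have h9n : (9 : ℝ) ^ J ≤ n := by exact_mod_cast hJn
  -- The rounding error `1` is absorbed by `n / 9 ^ J ≥ 1`.
  have hRle : (R : ℝ) ≤ 9 * n / 9 ^ J := by
    have h1 := (Nat.ceil_lt_add_one (a := 8 * (n : ℝ) / 9 ^ J) (by positivity)).le
    have h2 : 1 ≤ (n : ℝ) / 9 ^ J := by rwa [one_le_div (by positivity)]
    calc (R : ℝ) ≤ 8 * n / 9 ^ J + n / 9 ^ J := h1.trans (by gcongr)
      _ = 9 * n / 9 ^ J := by ring
  have hz : (0 : ℝ) < 3 ^ J := by positivity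
  have hH' : (hybridComplexity q (orFn n) : ℝ) ≤ 27 / 2 * (n / 3 ^ J) := by
    have : (R : ℝ) * (3 * 3 ^ J) ≤ 9 * n / 9 ^ J * (3 * 3 ^ J) := by gcongr
    have h2 : 9 * (n : ℝ) / 9 ^ J * (3 * 3 ^ J) = 27 * (n / 3 ^ J) := by
      rw [h9]; field_simp; ring
    linarith
  -- By maximality of `J` one constraint fails at `J + 1`: the query limit gives the term `n / q`,
  -- the size of `n` gives `√n`.
  have hfin : (n : ℝ) / 3 ^ J ≤ 3 * ((n : ℝ) / q + √n) := by
    have hnq : 0 ≤ (n : ℝ) / q := by positivity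
    rw [not_and_or, not_le, not_le] at hJ
    rcases hJ with h | h
    · have h' : (2 * q + 1 : ℝ) < 3 ^ J * 3 := by rw [← pow_succ]; exact_mod_cast h
      have : (n : ℝ) / 3 ^ J ≤ 3 * (n / q) := by
        rw [← mul_div_assoc, div_le_div_iff₀ hz hq0]
        nlinarith
      linarith [Real.sqrt_nonneg (n : ℝ)]
    · have h' : (n : ℝ) < 9 ^ J * 9 := by rw [← pow_succ]; exact_mod_cast h
      have hs : √(n : ℝ) ≤ 3 * 3 ^ J := by
        rw [Real.sqrt_le_left (by positivity)]
        rw [h9] at h'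
        linarith
      have : (n : ℝ) / 3 ^ J ≤ 3 * √n := by
        rw [div_le_iff₀ hz]
        nlinarith [Real.mul_self_sqrt hn.le, Real.sqrt_nonneg (n : ℝ)]
      linarith
  have hnn : 0 ≤ (n : ℝ) / q + √n := by positivity
  linarith

end HybridQuery

theorem mainTheorem3 :
    (∃ c : ℝ, 0 < c ∧
      ∀ (n : ℕ) [NeZero n] (D : Set (HybridQuery.Input n)) (f : D → Bool) (q : ℕ), 1 ≤ q →
        c * ((HybridQuery.blockSensitivity f : ℝ) / (q : ℝ)
            + Real.sqrt (HybridQuery.blockSensitivity f : ℝ))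
          ≤ (HybridQuery.hybridComplexity q f : ℝ)) ∧
    (∃ C : ℝ, 0 < C ∧
      ∀ (n : ℕ) [NeZero n] (q : ℕ), 1 ≤ q →
        (HybridQuery.hybridComplexity q (HybridQuery.orFn n) : ℝ)
          ≤ C * ((HybridQuery.blockSensitivity (HybridQuery.orFn n) : ℝ) / (q : ℝ)
            + Real.sqrt (HybridQuery.blockSensitivity (HybridQuery.orFn n) : ℝ))) := by
  refine ⟨⟨1 / 156, by norm_num, fun n _ D f q hq => HybridQuery.le_hybridComplexity f hq⟩,
    45, by norm_num, fun n _ q hq => (HybridQuery.hybridComplexity_orFn_le n hq).trans ?_⟩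
  have : (n : ℝ) ≤ HybridQuery.blockSensitivity (HybridQuery.orFn n) := by
    exact_mod_cast HybridQuery.le_blockSensitivity_orFn n
  gcongr
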